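/- Let $\mathcal L$ be the set of cumulative distribution functions (CDFs) on $\mathbb R$, and for $F,G\in\mathcal L$ let $$W_1(F,G)=\inf_{\pi}\int_{\mathbb R^2}|x-y|\,d\pi(x,y)\in[0,\infty],$$ where the infimum is over all joint distributions $\pi$ on $\mathbb R^2$ with marginals $F$ and $G$. A risk measure is a map $\rho:\mathcal L\to\mathbb R$; for a real random variable $X$ with CDF $F$ write $\rho(X)=\rho(F)$. We say that $\rho$ is of type T1 with parameters $L>0$ and $\kappa\in(0,1]$ if $$|\rho(F)-\rho(G)|\le L\,W_1(F,G)^{\kappa}\qquad\text{for all }F,G\in\mathcal L$$ (no condition when $W_1(F,G)=\infty$). Given i.i.d. samples $X_1,\dots,X_n$ from the distribution of $X$, let $F_n(x)=\frac1n\sum_{i=1}^n\mathbf 1\{X_i\le x\}$ be the empirical distribution function and put $\rho_n=\rho(F_n)$. **(a)** Let $\beta>1$, $\gamma>0$ and $T<\infty$. There are constants $c_1,c_2,c_3>0$ depending only on $\beta,\gamma,T$ such that, for every random variable $X$ with $\mathbb E\exp(\gamma|X|^{\beta})<T$, every risk measure $\rho$ of type T1 with parameters $L$ and $\kappa$, every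 $n\ge1$ and every $\varepsilon>0$, $$\mathbb P\big(|\rho_n-\rho(X)|>\varepsilon\big)\le c_1\Big(\exp\!\Big(-c_2\,n\,\big(\tfrac{\varepsilon}{L}\big)^{2/\kappa}\Big)\mathbf 1\{\varepsilon\le L\}+\exp\!\Big(-c_3\,n\,\big(\tfrac{\varepsilon}{L}\big)^{\beta/\kappa}\Big)\mathbf 1\{\varepsilon> L\}\Big).$$ **(b)** Let $\gamma>0$. There are constants $c_1,c_2>0$ depending only on $\gamma$ such that, for every sub-Gaussian random variable $X$ with parameter $\gamma$, i.e. $\mathbb E\exp(\gamma X^2)\le2$, every risk measure $\rho$ of type T1 with parameters $L$ and $\kappa$, every $n\ge1$ and every $\varepsilon\ge0$, $$\mathbb P\big(|\rho_n-\rho(X)|>\varepsilon\big)\le 2c_1\exp\!\Big(-c_2\,n\,\big(\tfrac{\varepsilon}{L}\big)^{2/\kappa}\Big);$$ in particular, if $\kappa=1$, then $\mathbb P(|\rho_n-\rho(X)|>\varepsilon)\le 2c_1\exp\!\big(-\tfrac{c_2}{L^2}\,n\,\varepsilon^2\big)$. -/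

import Mathlib

open MeasureTheory ProbabilityTheory Filter Topology

namespace RiskMeasure

/-- The space of cumulative distribution functions on `ℝ`: nondecreasing right-continuous
functions with limits `0` at `-∞` and `1` at `+∞`. -/
structure CDF where
  toStieltjes : StieltjesFunction ℝ
  tendsto_atBot : Tendsto toStieltjes atBot (𝓝 0)
  tendsto_atTop : Tendsto toStieltjes atTop (𝓝 1)

/-- The probability distribution on `ℝ` whose CDF is `F` (its Lebesgue-Stieltjes measure). -/
noncomputable def CDF.law (F : CDF) : Measure ℝ := F.toStieltjes.measure

/-- The set `Γ(F, G)` of joint distributions on `ℝ²` with marginals `F` and `G`. -/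
def couplings (F G : CDF) : Set (Measure (ℝ × ℝ)) :=
  {π | IsProbabilityMeasure π ∧ π.map Prod.fst = F.law ∧ π.map Prod.snd = G.law}

/-- The Wasserstein distance `W₁(F, G) = inf_π ∫ |x - y| dπ(x, y)`, with values in `[0, ∞]`
(it is infinite when every coupling has infinite transport cost). -/
noncomputable def W1 (F G : CDF) : ENNReal :=
  ⨅ π ∈ couplings F G, ∫⁻ z, ENNReal.ofReal |z.1 - z.2| ∂π

/-- The CDF of a real random variable `X` on a probability space `(Ω, P)`. -/
noncomputable def cdfOf {Ω : Type*} [MeasurableSpace Ω] (X : Ω → ℝ) (P : Measure Ω) : CDF where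
  toStieltjes := cdf (P.map X)
  tendsto_atBot := tendsto_cdf_atBot _
  tendsto_atTop := tendsto_cdf_atTop _

/-- The function `t ↦ (1/n) ∑ᵢ 1{xᵢ ≤ t}`. -/
noncomputable def edfFun {n : ℕ} (x : Fin n → ℝ) (t : ℝ) : ℝ :=
  (1 / (n : ℝ)) * ∑ i : Fin n, if x i ≤ t then (1 : ℝ) else 0

theorem edfFun_mono {n : ℕ} (x : Fin n → ℝ) : Monotone (edfFun x) := by
  intro s t hst
  unfold edfFun
  refine mul_le_mul_of_nonneg_left (Finset.sum_le_sum fun i _ => ?_) (by positivity)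
  by_cases h : x i ≤ s
  · simp [h, h.trans hst]
  · rw [if_neg h]
    split_ifs <;> norm_num

theorem edfFun_rightCont {n : ℕ} (x : Fin n → ℝ) (t : ℝ) :
    ContinuousWithinAt (edfFun x) (Set.Ici t) t := by
  unfold edfFun
  refine continuousWithinAt_const.mul (tendsto_finsetSum _ fun i _ => ?_)
  refine tendsto_const_nhds.congr' ?_
  by_cases h : x i ≤ t
  · filter_upwards [self_mem_nhdsWithin] with s hs
    rw [if_pos h, if_pos (h.trans hs)]
  · filter_upwards [mem_nhdsWithin_of_mem_nhds (Iio_mem_nhds (not_le.1 h))] with s hs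
    rw [if_neg h, if_neg (not_le.2 hs)]

theorem edfFun_atBot {n : ℕ} (x : Fin n → ℝ) : Tendsto (edfFun x) atBot (𝓝 0) := by
  have h : Tendsto (fun t => ∑ i : Fin n, if x i ≤ t then (1 : ℝ) else 0) atBot
      (𝓝 (∑ _i : Fin n, (0 : ℝ))) := by
    refine tendsto_finsetSum _ fun i _ => tendsto_const_nhds.congr' ?_
    filter_upwards [eventually_lt_atBot (x i)] with s hs
    rw [if_neg (not_le.2 hs)]
  have h2 := h.const_mul (1 / (n : ℝ))
  rw [Finset.sum_const_zero, mul_zero] at h2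
  exact h2

theorem edfFun_atTop {n : ℕ} (hn : 1 ≤ n) (x : Fin n → ℝ) :
    Tendsto (edfFun x) atTop (𝓝 1) := by
  have h : Tendsto (fun t => ∑ i : Fin n, if x i ≤ t then (1 : ℝ) else 0) atTop
      (𝓝 (∑ _i : Fin n, (1 : ℝ))) := by
    refine tendsto_finsetSum _ fun i _ => tendsto_const_nhds.congr' ?_
    filter_upwards [eventually_ge_atTop (x i)] with s hs
    rw [if_pos hs]
  have hn0 : (n : ℝ) ≠ 0 := by positivity
  have h2 := h.const_mul (1 / (n : ℝ))
  rw [Finset.sum_const, Finset.card_univ, Fintype.card_fin, nsmul_eq_mul, mul_one,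
    one_div_mul_cancel hn0] at h2
  exact h2

/-- The empirical distribution function of the sample `x₁, …, xₙ` (with `n ≥ 1`). -/
noncomputable def edf {n : ℕ} (hn : 1 ≤ n) (x : Fin n → ℝ) : CDF where
  toStieltjes := ⟨edfFun x, edfFun_mono x, edfFun_rightCont x⟩
  tendsto_atBot := edfFun_atBot x
  tendsto_atTop := edfFun_atTop hn x

/-- A risk measure `ρ` is of type T1 with parameters `L > 0` and `κ ∈ (0, 1]` if
`|ρ(F) - ρ(G)| ≤ L W₁(F, G)^κ` for all CDFs `F`, `G`; this is no constraint when
`W₁(F, G) = ∞`. -/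
structure IsType1 (ρ : CDF → ℝ) (L κ : ℝ) : Prop where
  L_pos : 0 < L
  κ_pos : 0 < κ
  κ_le_one : κ ≤ 1
  holder : ∀ F G : CDF, ENNReal.ofReal |ρ F - ρ G| ≤ ENNReal.ofReal L * W1 F G ^ κ

/-- The exponential moment bound `E exp(γ |X|^β) < T < ∞`. -/
structure ExpMomentBound {Ω : Type*} [MeasurableSpace Ω] (X : Ω → ℝ) (P : Measure Ω)
    (β γ T : ℝ) : Prop where
  aemeasurable : AEMeasurable X P
  integrable : Integrable (fun ω => Real.exp (γ * |X ω| ^ β)) P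
  bound : ∫ ω, Real.exp (γ * |X ω| ^ β) ∂P < T

/-- `X` is sub-Gaussian with parameter `γ`: `E exp(γ X²) ≤ 2`. -/
structure IsSubGaussian {Ω : Type*} [MeasurableSpace Ω] (X : Ω → ℝ) (P : Measure Ω)
    (γ : ℝ) : Prop where
  aemeasurable : AEMeasurable X P
  γ_pos : 0 < γ
  integrable : Integrable (fun ω => Real.exp (γ * X ω ^ 2)) P
  bound : ∫ ω, Real.exp (γ * X ω ^ 2) ∂P ≤ 2

/-- `Y₁, …, Yₙ` (on `(Ω', P')`) are i.i.d. samples from the distribution of `X` (on `(Ω, P)`). -/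
structure IsIIDSample {Ω Ω' : Type*} [MeasurableSpace Ω] [MeasurableSpace Ω'] {n : ℕ}
    (Y : Fin n → Ω' → ℝ) (P' : Measure Ω') (X : Ω → ℝ) (P : Measure Ω) : Prop where
  indep : iIndepFun Y P'
  identDistrib : ∀ i, IdentDistrib (Y i) X P' P

end RiskMeasure

namespace RiskMeasure

/-! The quantile coupling gives `W1 F G ≤ ∫ |F - G|`, and the T1 condition turns a deviation larger
than `ε` into `W₁ > (ε/L)^(1/κ)`. It therefore suffices to bound the tail of `edfDist`, the distance
`∫ |Fₙ - F| dt`, at level `a`.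

For bounded `a` (`measure_edfDist_gt_le`), write this distance as the mean of `v |Fₙ - F|` under the
probability `dt / v(t)`, where `v(t) = J (1 + |t|)^β`; such a `J` exists because `β > 1`. Jensen and
Tonelli reduce its exponential moment to those of `Fₙ(t) - F(t)` at fixed `t`, a centred binomial
average of variance proportional to `F(1 - F)`. The moment assumption makes `F(1 - F)` decay like
`exp(-g (1 + |t|)^β)`, which beats the factor `exp(s v(t))` for small `s`.

For large `a` (`measure_edfDist_gt_le_of_ge`), the distance is at most the sample mean of `|xᵢ|`
plus a constant. Convexity of `x ↦ x^β` and Markov's inequality for `∏ exp(γ |xᵢ|^β)` then give the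
exponent `a^β`.

Part (b) is the case `β = 2`, where the two regimes have the same exponent. -/

/-! ### Quantile coupling and the `L¹` bound on `W₁`. -/

theorem measurable_step {α : Type*} [MeasurableSpace α] {f g : α → ℝ} (hf : Measurable f)
    (hg : Measurable g) : Measurable fun z => if f z ≤ g z then (1 : ℝ) else 0 :=
  Measurable.ite (measurableSet_le hf hg) measurable_const measurable_const

theorem ofReal_abs_step_sub_step (a b t : ℝ) :
    ENNReal.ofReal |(if a ≤ t then (1 : ℝ) else 0) - if b ≤ t then (1 : ℝ) else 0| =
      (Set.Ico (min a b) (max a b)).indicator 1 t := by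
  by_cases ha : a ≤ t <;> by_cases hb : b ≤ t <;>
    simp [ha, hb, Set.indicator, not_lt.2, not_le.1]

theorem lintegral_abs_step_sub_step (a b : ℝ) :
    ∫⁻ t, ENNReal.ofReal |(if a ≤ t then (1 : ℝ) else 0) - if b ≤ t then (1 : ℝ) else 0| =
      ENNReal.ofReal |a - b| := by
  simp_rw [ofReal_abs_step_sub_step]
  rw [lintegral_indicator_one measurableSet_Ico, Real.volume_Ico, max_sub_min_eq_abs, abs_sub_comm]

theorem lintegral_abs_rev_step_sub_step (a b : ℝ) :
    ∫⁻ u, ENNReal.ofReal |(if u ≤ a then (1 : ℝ) else 0) - if u ≤ b then (1 : ℝ) else 0| =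
      ENNReal.ofReal |a - b| := by
  have h : ∀ u, ENNReal.ofReal
      |(if u ≤ a then (1 : ℝ) else 0) - if u ≤ b then (1 : ℝ) else 0| =
      (Set.Ioc (min a b) (max a b)).indicator 1 u := fun u => by
    by_cases ha : u ≤ a <;> by_cases hb : u ≤ b <;>
      simp [ha, hb, Set.indicator, not_lt.2, not_le.1]
  simp_rw [h]
  rw [lintegral_indicator_one measurableSet_Ioc, Real.volume_Ioc, max_sub_min_eq_abs, abs_sub_comm]

theorem CDF.isProbabilityMeasure_law (F : CDF) : IsProbabilityMeasure F.law :=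
  F.toStieltjes.isProbabilityMeasure F.tendsto_atBot F.tendsto_atTop

theorem CDF.le_one (F : CDF) (t : ℝ) : F.toStieltjes t ≤ 1 :=
  F.toStieltjes.mono.ge_of_tendsto F.tendsto_atTop t

/-- The quantile function (left-continuous inverse) of `F`, extended by `0` outside `(0, 1)`. -/
noncomputable def CDF.quantile (F : CDF) (u : ℝ) : ℝ :=
  open Classical in if u ∈ Set.Ioo (0 : ℝ) 1 then sInf {x | u ≤ F.toStieltjes x} else 0

/-- Right continuity of `F` puts the infimum itself in the set, so quantile and CDF form a Galois
connection on `(0, 1)`. -/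
theorem CDF.quantile_le_iff (F : CDF) {u : ℝ} (hu : u ∈ Set.Ioo (0 : ℝ) 1) (t : ℝ) :
    F.quantile u ≤ t ↔ u ≤ F.toStieltjes t := by
  rw [CDF.quantile, if_pos hu]
  have hbdd : BddBelow {x | u ≤ F.toStieltjes x} := by
    obtain ⟨m, hm⟩ := (F.tendsto_atBot.eventually (gt_mem_nhds hu.1)).exists
    exact ⟨m, fun x hx => le_of_not_ge fun h =>
      absurd (hx.trans (F.toStieltjes.mono h)) (not_le.2 hm)⟩
  have hne : {x | u ≤ F.toStieltjes x}.Nonempty := by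
    obtain ⟨m, hm⟩ := (F.tendsto_atTop.eventually (lt_mem_nhds hu.2)).exists
    exact ⟨m, hm.le⟩
  refine ⟨fun h => ?_, fun h => csInf_le hbdd h⟩
  refine le_trans ?_ (F.toStieltjes.mono h)
  set q := sInf {x | u ≤ F.toStieltjes x}
  have hc : Tendsto F.toStieltjes (𝓝[>] q) (𝓝 (F.toStieltjes q)) :=
    (F.toStieltjes.right_continuous q).mono_left (nhdsWithin_mono _ Set.Ioi_subset_Ici_self)
  refine ge_of_tendsto hc ?_
  filter_upwards [self_mem_nhdsWithin] with s hs
  obtain ⟨x, hx, hxs⟩ := exists_lt_of_csInf_lt hne hs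
  exact le_trans hx (F.toStieltjes.mono hxs.le)

theorem CDF.measurable_quantile (F : CDF) : Measurable F.quantile := by
  refine measurable_of_Iic fun t => ?_
  have h : F.quantile ⁻¹' Set.Iic t =
      (Set.Ioo 0 1 ∩ Set.Iic (F.toStieltjes t)) ∪ ((Set.Ioo 0 1)ᶜ ∩ {_u | 0 ≤ t}) := by
    ext u
    by_cases hu : u ∈ Set.Ioo (0 : ℝ) 1
    · simp only [Set.mem_preimage, Set.mem_Iic, F.quantile_le_iff hu, Set.mem_union,
        Set.mem_inter_iff, hu, Set.mem_compl_iff, true_and, not_true, false_and, or_false]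
    · simp only [Set.mem_preimage, Set.mem_Iic, CDF.quantile, Set.mem_union,
        Set.mem_inter_iff, hu, Set.mem_compl_iff, false_and, not_false_iff, true_and, false_or,
        Set.mem_ofPred_eq, if_false]
  rw [h]
  exact (measurableSet_Ioo.inter measurableSet_Iic).union
    (measurableSet_Ioo.compl.inter (MeasurableSet.const _))

theorem CDF.map_quantile (F : CDF) :
    (volume.restrict (Set.Ioo (0 : ℝ) 1)).map F.quantile = F.law := by
  have := F.isProbabilityMeasure_law
  refine (Measure.ext_of_Iic _ _ fun t => ?_).symm
  rw [Measure.map_apply F.measurable_quantile measurableSet_Iic,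
    Measure.restrict_apply (F.measurable_quantile measurableSet_Iic), CDF.law,
    F.toStieltjes.measure_Iic F.tendsto_atBot, sub_zero]
  have h1 : F.quantile ⁻¹' Set.Iic t ∩ Set.Ioo 0 1 =
      Set.Ioo 0 1 ∩ Set.Iic (F.toStieltjes t) := by
    ext u
    rw [Set.inter_comm]
    exact and_congr_right fun hu => F.quantile_le_iff hu t
  rw [h1]
  refine le_antisymm ?_ ?_
  · calc ENNReal.ofReal (F.toStieltjes t) = volume (Set.Ioo 0 (F.toStieltjes t)) := by simp
      _ ≤ volume (Set.Ioo 0 1 ∩ Set.Iic (F.toStieltjes t)) :=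
        measure_mono fun u hu => ⟨⟨hu.1, hu.2.trans_le (F.le_one t)⟩, hu.2.le⟩
  · calc volume (Set.Ioo 0 1 ∩ Set.Iic (F.toStieltjes t))
        ≤ volume (Set.Ioc 0 (F.toStieltjes t)) := measure_mono fun u hu => ⟨hu.1.1, hu.2⟩
      _ = _ := by simp

/-- In dimension one `W₁` is at most the `L¹` distance of the CDFs (it is in fact equal to it). -/
theorem W1_le_lintegral (F G : CDF) :
    W1 F G ≤ ∫⁻ t, ENNReal.ofReal |F.toStieltjes t - G.toStieltjes t| := by
  have hq : Measurable fun u => (F.quantile u, G.quantile u) :=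
    F.measurable_quantile.prodMk G.measurable_quantile
  have hprob : IsProbabilityMeasure (volume.restrict (Set.Ioo (0 : ℝ) 1)) := ⟨by simp⟩
  have hmem : (volume.restrict (Set.Ioo (0 : ℝ) 1)).map (fun u => (F.quantile u, G.quantile u)) ∈
      couplings F G := by
    refine ⟨Measure.isProbabilityMeasure_map hq.aemeasurable, ?_, ?_⟩
    · rw [Measure.map_map measurable_fst hq, ← F.map_quantile]; rfl
    · rw [Measure.map_map measurable_snd hq, ← G.map_quantile]; rfl
  refine (iInf₂_le _ hmem).trans ?_
  rw [lintegral_map (by fun_prop) hq]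
  -- The cost `|a - b|` is the integral over `t` of the difference of the steps at `a` and `b`.
  -- After Tonelli, the Galois connection turns these into steps in the level `u`, which integrate
  -- to `|F t - G t|`.
  rw [lintegral_congr fun u => (lintegral_abs_step_sub_step (F.quantile u) (G.quantile u)).symm,
    lintegral_lintegral_swap]
  · refine lintegral_mono fun t => ?_
    rw [← lintegral_abs_rev_step_sub_step]
    refine le_trans (le_of_eq ?_) (setLIntegral_le_lintegral (Set.Ioo 0 1) _)
    refine setLIntegral_congr_fun measurableSet_Ioo fun u hu => ?_
    simp only [F.quantile_le_iff hu, G.quantile_le_iff hu]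
  · refine (ENNReal.measurable_ofReal.comp (Measurable.abs ?_)).aemeasurable
    exact (measurable_step (F.measurable_quantile.comp measurable_fst) measurable_snd).sub
      (measurable_step (G.measurable_quantile.comp measurable_fst) measurable_snd)

theorem IsType1.lt_W1 {ρ : CDF → ℝ} {L κ : ℝ} (h : IsType1 ρ L κ) {F G : CDF} {ε : ℝ}
    (hε : 0 < ε) (hlt : ε < |ρ F - ρ G|) : ENNReal.ofReal ((ε / L) ^ (1 / κ)) < W1 F G := by
  by_contra hle
  rw [not_lt] at hle
  have hd : 0 ≤ ε / L := (div_pos hε h.L_pos).le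
  have h1 := (ENNReal.rpow_le_rpow hle h.κ_pos.le)
  rw [ENNReal.ofReal_rpow_of_nonneg (Real.rpow_nonneg hd _) h.κ_pos.le, ← Real.rpow_mul hd,
    one_div_mul_cancel h.κ_pos.ne', Real.rpow_one] at h1
  have h2 := (h.holder F G).trans (mul_le_mul_right h1 (ENNReal.ofReal L))
  rw [← ENNReal.ofReal_mul h.L_pos.le, mul_div_cancel₀ _ h.L_pos.ne',
    ENNReal.ofReal_le_ofReal_iff hε.le] at h2
  exact absurd hlt (not_lt.2 h2)


/-! ### Exponential moments of `Fₙ - F` and the weighted Chernoff bound. -/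

theorem exp_le_one_add_add_sq_mul (y : ℝ) : Real.exp y ≤ 1 + y + y ^ 2 * Real.exp |y| := by
  have h := Complex.norm_exp_sub_sum_le_norm_mul_exp (y : ℂ) 2
  rw [Complex.norm_real, Real.norm_eq_abs, sq_abs] at h
  have h2 : Complex.exp y - ∑ m ∈ Finset.range 2, (y : ℂ) ^ m / (m.factorial : ℂ) =
      ((Real.exp y - (1 + y) : ℝ) : ℂ) := by
    simp [Finset.sum_range_succ]
  rw [h2, Complex.norm_real, Real.norm_eq_abs] at h
  linarith [le_abs_self (Real.exp y - (1 + y))]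

/-- Unlike in Hoeffding's lemma, the variance `p (1 - p)` stays in the exponent: its decay in `t`
must later compensate a `θ` that grows with `t`. -/
theorem bernoulli_mgf_le {p : ℝ} (h0 : 0 ≤ p) (h1 : p ≤ 1) (θ : ℝ) :
    (1 - p) * Real.exp (θ * (0 - p)) + p * Real.exp (θ * (1 - p)) ≤
      Real.exp (θ ^ 2 * Real.exp |θ| * (p * (1 - p))) := by
  have key : ∀ ξ : ℝ, |ξ| ≤ 1 →
      Real.exp (θ * ξ) ≤ 1 + θ * ξ + θ ^ 2 * ξ ^ 2 * Real.exp |θ| := fun ξ hξ => by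
    refine (exp_le_one_add_add_sq_mul _).trans ?_
    rw [mul_pow, abs_mul]
    have : Real.exp (|θ| * |ξ|) ≤ Real.exp |θ| :=
      Real.exp_le_exp.2 (mul_le_of_le_one_right (abs_nonneg _) hξ)
    gcongr
  have e0 := mul_le_mul_of_nonneg_left
    (key (0 - p) (abs_le.2 ⟨by linarith, by linarith⟩)) (sub_nonneg.2 h1)
  have e1 := mul_le_mul_of_nonneg_left
    (key (1 - p) (abs_le.2 ⟨by linarith, by linarith⟩)) h0
  refine (add_le_add e0 e1).trans (le_trans (le_of_eq ?_) (Real.add_one_le_exp _))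
  ring

theorem integral_exp_step_le (μ : Measure ℝ) [IsProbabilityMeasure μ] (t θ : ℝ) :
    ∫ y, Real.exp (θ * ((if y ≤ t then (1 : ℝ) else 0) - cdf μ t)) ∂μ ≤
      Real.exp (θ ^ 2 * Real.exp |θ| * (cdf μ t * (1 - cdf μ t))) := by
  refine le_trans (le_of_eq ?_) (bernoulli_mgf_le (cdf_nonneg μ t) (cdf_le_one μ t) θ)
  set p := cdf μ t with hp
  have h : ∀ y, Real.exp (θ * ((if y ≤ t then (1 : ℝ) else 0) - p)) =
      Real.exp (θ * (0 - p)) +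
        (Set.Iic t).indicator 1 y * (Real.exp (θ * (1 - p)) - Real.exp (θ * (0 - p))) :=
    fun y => by
      by_cases hy : y ≤ t <;> simp [hy]
  have hi : Integrable ((Set.Iic t).indicator (1 : ℝ → ℝ)) μ :=
    (integrable_const (1 : ℝ)).indicator measurableSet_Iic
  simp_rw [h]
  rw [integral_add (integrable_const _) (hi.mul_const _),
    integral_mul_const, integral_indicator_one measurableSet_Iic, ← cdf_eq_real, ← hp]
  simp
  ring

theorem measurable_edfFun {n : ℕ} :
    Measurable fun z : (Fin n → ℝ) × ℝ => edfFun z.1 z.2 := by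
  unfold edfFun
  exact measurable_const.mul (Finset.measurable_sum _ fun i _ =>
    measurable_step ((measurable_pi_apply i).comp measurable_fst) measurable_snd)

theorem natCast_mul_edfFun_sub {n : ℕ} (hn : 1 ≤ n) (x : Fin n → ℝ) (t p : ℝ) :
    n * (edfFun x t - p) = ∑ i, ((if x i ≤ t then (1 : ℝ) else 0) - p) := by
  have hn0 : (n : ℝ) ≠ 0 := by positivity
  rw [Finset.sum_sub_distrib, edfFun]
  simp only [Finset.sum_const, Finset.card_univ, Fintype.card_fin, nsmul_eq_mul]
  field_simp

theorem integral_exp_edfFun_le {n : ℕ} (hn : 1 ≤ n) (μ : Measure ℝ) [IsProbabilityMeasure μ]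
    (t θ : ℝ) :
    ∫⁻ x, ENNReal.ofReal (Real.exp (θ * (n * (edfFun x t - cdf μ t))))
        ∂(Measure.pi fun _ : Fin n => μ) ≤
      ENNReal.ofReal (Real.exp (n * (θ ^ 2 * Real.exp |θ| * (cdf μ t * (1 - cdf μ t))))) := by
  have hmeas : Measurable fun y => Real.exp (θ * ((if y ≤ t then (1 : ℝ) else 0) - cdf μ t)) :=
    (((measurable_step measurable_id measurable_const).sub_const _).const_mul _).exp
  have hint : Integrable
      (fun y => Real.exp (θ * ((if y ≤ t then (1 : ℝ) else 0) - cdf μ t))) μ := by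
    refine Integrable.of_bound hmeas.aestronglyMeasurable
      (Real.exp (θ * (0 - cdf μ t)) + Real.exp (θ * (1 - cdf μ t))) (ae_of_all _ fun y => ?_)
    rw [Real.norm_eq_abs, Real.abs_exp]
    split_ifs
    · linarith [Real.exp_pos (θ * (0 - cdf μ t))]
    · linarith [Real.exp_pos (θ * (1 - cdf μ t))]
  have h : ∀ x : Fin n → ℝ, Real.exp (θ * (n * (edfFun x t - cdf μ t))) =
      ∏ i, Real.exp (θ * ((if x i ≤ t then (1 : ℝ) else 0) - cdf μ t)) := fun x => by
    rw [natCast_mul_edfFun_sub hn, Finset.mul_sum, Real.exp_sum]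
  simp_rw [h]
  rw [← ofReal_integral_eq_lintegral_ofReal (Integrable.fintype_prod fun _ => hint)
    (ae_of_all _ fun x => Finset.prod_nonneg fun i _ => (Real.exp_pos _).le),
    integral_fintype_prod_eq_prod
      (fun _ y => Real.exp (θ * ((if y ≤ t then (1 : ℝ) else 0) - cdf μ t)))]
  refine ENNReal.ofReal_le_ofReal ?_
  rw [Finset.prod_const, Finset.card_univ, Fintype.card_fin, Real.exp_nat_mul]
  exact pow_le_pow_left₀ (integral_nonneg fun _ => (Real.exp_pos _).le)
    (integral_exp_step_le μ t θ) n

theorem integral_exp_abs_edfFun_le {n : ℕ} (hn : 1 ≤ n) (μ : Measure ℝ) [IsProbabilityMeasure μ]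
    (t θ : ℝ) :
    ∫⁻ x, ENNReal.ofReal (Real.exp (θ * (n * |edfFun x t - cdf μ t|)))
        ∂(Measure.pi fun _ : Fin n => μ) ≤
      ENNReal.ofReal
        (2 * Real.exp (n * (θ ^ 2 * Real.exp |θ| * (cdf μ t * (1 - cdf μ t))))) := by
  have hm : ∀ θ : ℝ, Measurable fun x : Fin n → ℝ =>
      ENNReal.ofReal (Real.exp (θ * (n * (edfFun x t - cdf μ t)))) := fun θ =>
    ENNReal.measurable_ofReal.comp (Measurable.exp ((((measurable_edfFun.comp
      (measurable_id.prodMk measurable_const)).sub_const _).const_mul _).const_mul _))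
  have h1 := integral_exp_edfFun_le hn μ t θ
  have h2 := integral_exp_edfFun_le hn μ t (-θ)
  rw [neg_sq, abs_neg] at h2
  rw [two_mul, ENNReal.ofReal_add (Real.exp_pos _).le (Real.exp_pos _).le]
  refine le_trans ?_ (add_le_add h1 h2)
  rw [← lintegral_add_left (hm θ)]
  refine lintegral_mono fun x => ?_
  rw [← ENNReal.ofReal_add (Real.exp_pos _).le (Real.exp_pos _).le]
  refine ENNReal.ofReal_le_ofReal ?_
  rcases abs_choice (edfFun x t - cdf μ t) with h | h <;> rw [h]
  · linarith [Real.exp_pos (-θ * (n * (edfFun x t - cdf μ t)))]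
  · rw [show θ * (n * -(edfFun x t - cdf μ t)) = -θ * (n * (edfFun x t - cdf μ t)) by ring]
    linarith [Real.exp_pos (θ * (n * (edfFun x t - cdf μ t)))]

/-- Jensen's inequality for the exponential of a nonnegative function, without integrability
assumptions. -/
theorem ofReal_exp_le_lintegral {α : Type*} [MeasurableSpace α] {ν : Measure α}
    [IsProbabilityMeasure ν] {f : α → ℝ} (hf : Measurable f) (h0 : ∀ x, 0 ≤ f x) {a : ℝ}
    (ha : ENNReal.ofReal a ≤ ∫⁻ x, ENNReal.ofReal (f x) ∂ν) :
    ENNReal.ofReal (Real.exp a) ≤ ∫⁻ x, ENNReal.ofReal (Real.exp (f x)) ∂ν := by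
  by_cases hfin : ∫⁻ x, ENNReal.ofReal (Real.exp (f x)) ∂ν = ⊤
  · rw [hfin]; exact le_top
  have hexp : Integrable (fun x => Real.exp (f x)) ν :=
    (lintegral_ofReal_ne_top_iff_integrable hf.exp.aestronglyMeasurable
      (ae_of_all _ fun x => (Real.exp_pos _).le)).1 hfin
  have hint : Integrable f ν := by
    refine hexp.mono' hf.aestronglyMeasurable (ae_of_all _ fun x => ?_)
    rw [Real.norm_eq_abs, abs_of_nonneg (h0 x)]
    linarith [Real.add_one_le_exp (f x)]
  rw [← ofReal_integral_eq_lintegral_ofReal hint (ae_of_all _ h0),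
    ENNReal.ofReal_le_ofReal_iff (integral_nonneg h0)] at ha
  rw [← ofReal_integral_eq_lintegral_ofReal hexp (ae_of_all _ fun x => (Real.exp_pos _).le)]
  refine ENNReal.ofReal_le_ofReal ((Real.exp_le_exp.2 ha).trans ?_)
  exact convexOn_exp.map_integral_le Real.continuous_exp.continuousOn isClosed_univ
    (ae_of_all _ fun _ => Set.mem_univ _) hint hexp

/-- The `L¹` distance between the empirical distribution function and the CDF of `μ`. -/
noncomputable def edfDist (μ : Measure ℝ) {n : ℕ} (x : Fin n → ℝ) : ENNReal :=
  ∫⁻ t, ENNReal.ofReal |edfFun x t - cdf μ t|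

theorem measurable_abs_edfFun_sub (μ : Measure ℝ) {n : ℕ} :
    Measurable fun z : (Fin n → ℝ) × ℝ => |edfFun z.1 z.2 - cdf μ z.2| :=
  (measurable_edfFun.sub ((cdf μ).mono.measurable.comp measurable_snd)).abs

/-- Chernoff bound for the `L¹` distance, given a weight `1 / v` of mass one for which the
pointwise exponential moments are controlled. -/
theorem measure_edfDist_gt_le {n : ℕ} (hn : 1 ≤ n) (μ : Measure ℝ) [IsProbabilityMeasure μ]
    {v : ℝ → ℝ} (hv : Measurable v) (hv0 : ∀ t, 0 < v t)
    (hv1 : ∫⁻ t, ENNReal.ofReal (v t)⁻¹ = 1) {s B : ℝ} (hs : 0 ≤ s)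
    (hB : ∀ t, (s * v t) ^ 2 * Real.exp (s * v t) * (cdf μ t * (1 - cdf μ t)) ≤ B) (a : ℝ) :
    (Measure.pi fun _ : Fin n => μ) {x | ENNReal.ofReal a < edfDist μ x} ≤
      ENNReal.ofReal (2 * Real.exp (-n * (s * a - B))) := by
  set ν : Measure ℝ := volume.withDensity fun t => ENNReal.ofReal (v t)⁻¹
  have hvm : Measurable fun t => ENNReal.ofReal (v t)⁻¹ := ENNReal.measurable_ofReal.comp hv.inv
  have hν : IsProbabilityMeasure ν := 
    ⟨by rw [withDensity_apply _ MeasurableSet.univ, Measure.restrict_univ, hv1]⟩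
  set f : (Fin n → ℝ) → ℝ → ℝ := fun x t => s * v t * (n * |edfFun x t - cdf μ t|)
  have hf : Measurable (Function.uncurry f) :=
    ((hv.comp measurable_snd).const_mul s).mul ((measurable_abs_edfFun_sub μ).const_mul _)
  have hfx : ∀ x, Measurable (f x) := fun x => hf.comp measurable_prodMk_left
  have hf0 : ∀ x t, 0 ≤ f x t := fun x t =>
    mul_nonneg (mul_nonneg hs (hv0 t).le) (by positivity)
  have hH : Measurable fun z : (Fin n → ℝ) × ℝ =>
      ENNReal.ofReal (Real.exp (Function.uncurry f z)) := ENNReal.measurable_ofReal.comp hf.exp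
  -- Jensen for the probability `ν`: the factor `v` in `f` cancels the density `1 / v`, so the
  -- `ν`-mean of `f x` is `n s` times `edfDist μ x`.
  have hsub : {x : Fin n → ℝ | ENNReal.ofReal a < edfDist μ x} ⊆
      {x | ENNReal.ofReal (Real.exp (n * s * a)) ≤
        ∫⁻ t, ENNReal.ofReal (Real.exp (f x t)) ∂ν} := fun x hx => by
    refine ofReal_exp_le_lintegral (hfx x) (hf0 x) ?_
    have hfm : Measurable fun t => ENNReal.ofReal (f x t) := ENNReal.measurable_ofReal.comp (hfx x)
    rw [lintegral_withDensity_eq_lintegral_mul _ hvm hfm]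
    have hns : 0 ≤ n * s := by positivity
    calc ENNReal.ofReal (n * s * a) = ENNReal.ofReal (n * s) * ENNReal.ofReal a :=
          ENNReal.ofReal_mul hns
      _ ≤ ENNReal.ofReal (n * s) * edfDist μ x := mul_le_mul_right (le_of_lt hx) _
      _ = ∫⁻ t, ENNReal.ofReal (n * s) * ENNReal.ofReal |edfFun x t - cdf μ t| :=
          (lintegral_const_mul _ (ENNReal.measurable_ofReal.comp
            ((measurable_abs_edfFun_sub μ).comp measurable_prodMk_left))).symm
      _ = _ := lintegral_congr fun t => by
          rw [Pi.mul_apply, ← ENNReal.ofReal_mul hns,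
            ← ENNReal.ofReal_mul (inv_nonneg.2 (hv0 t).le)]
          congr 1
          have := (hv0 t).ne'
          simp only [f]
          field_simp
  refine (measure_mono hsub).trans ((meas_ge_le_lintegral_div
    (Measurable.lintegral_prod_right' hH).aemeasurable
    (ENNReal.ofReal_pos.2 (Real.exp_pos _)).ne' ENNReal.ofReal_ne_top).trans ?_)
  rw [ENNReal.div_le_iff (ENNReal.ofReal_pos.2 (Real.exp_pos _)).ne' ENNReal.ofReal_ne_top,
    ← ENNReal.ofReal_mul (by positivity), mul_assoc, ← Real.exp_add,
    show -n * (s * a - B) + n * s * a = n * B by ring]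
  change ∫⁻ x, ∫⁻ t, ENNReal.ofReal (Real.exp (f x t)) ∂ν ∂_ ≤ _
  rw [lintegral_lintegral_swap hH.aemeasurable]
  calc _ ≤ ∫⁻ _t, ENNReal.ofReal (2 * Real.exp (n * B)) ∂ν := lintegral_mono fun t => by
        refine (integral_exp_abs_edfFun_le hn μ t (s * v t)).trans (ENNReal.ofReal_le_ofReal ?_)
        rw [abs_of_nonneg (mul_nonneg hs (hv0 t).le)]
        have := hB t
        gcongr
    _ = _ := by simp


/-! ### Tail decay and the sub-Gaussian regime. -/

theorem cdf_mul_one_sub_le (μ : Measure ℝ) [IsProbabilityMeasure μ] (t : ℝ) :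
    cdf μ t * (1 - cdf μ t) ≤ μ.real {y | |t| ≤ |y|} := by
  have h0 := cdf_nonneg μ t
  have h1 := cdf_le_one μ t
  rcases le_or_gt 0 t with ht | ht
  · refine (mul_le_of_le_one_left (sub_nonneg.2 h1) h1).trans ?_
    rw [cdf_eq_real, ← probReal_compl_eq_one_sub measurableSet_Iic]
    refine measureReal_mono fun y hy => ?_
    rw [Set.mem_compl_iff, Set.mem_Iic, not_le] at hy
    exact abs_le_abs_of_nonneg ht hy.le
  · refine (mul_le_of_le_one_right h0 (by linarith)).trans ?_
    rw [cdf_eq_real]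
    refine measureReal_mono fun y hy => ?_
    exact abs_le_abs_of_nonpos ht.le hy

theorem measureReal_abs_ge_le (μ : Measure ℝ) {β γ T : ℝ} (hβ : 0 ≤ β) (hγ : 0 ≤ γ)
    (hint : Integrable (fun y => Real.exp (γ * |y| ^ β)) μ)
    (hT : ∫ y, Real.exp (γ * |y| ^ β) ∂μ ≤ T) [IsFiniteMeasure μ] (t : ℝ) :
    μ.real {y | |t| ≤ |y|} ≤ T * Real.exp (-(γ * |t| ^ β)) := by
  have h := (mul_meas_ge_le_integral_of_nonneg (ae_of_all _ fun y => (Real.exp_pos _).le) hint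
    (Real.exp (γ * |t| ^ β))).trans hT
  have hsub : μ.real {y | |t| ≤ |y|} ≤
      μ.real {y | Real.exp (γ * |t| ^ β) ≤ Real.exp (γ * |y| ^ β)} := by
    refine measureReal_mono fun y hy => ?_
    have hy : |t| ≤ |y| := hy
    change Real.exp (γ * |t| ^ β) ≤ Real.exp (γ * |y| ^ β)
    gcongr
  rw [Real.exp_neg, ← div_eq_mul_inv, le_div_iff₀ (Real.exp_pos _), mul_comm]
  exact (mul_le_mul_of_nonneg_left hsub (Real.exp_pos _).le).trans h

/-- Serves to express the tail decay through `(1 + |t|)^β`, the same function as in the weight `v`.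
-/
theorem one_add_rpow_le {a β : ℝ} (ha : 0 ≤ a) (hβ : 0 ≤ β) :
    (1 + a) ^ β ≤ 2 ^ β * (1 + a ^ β) := by
  have hp := Real.rpow_nonneg ha β
  rcases le_total a 1 with h | h
  · calc (1 + a) ^ β ≤ 2 ^ β := Real.rpow_le_rpow (by linarith) (by linarith) hβ
      _ ≤ 2 ^ β * (1 + a ^ β) := le_mul_of_one_le_right (by positivity) (by linarith)
  · calc (1 + a) ^ β ≤ (2 * a) ^ β := Real.rpow_le_rpow (by linarith) (by linarith) hβ
      _ = 2 ^ β * a ^ β := Real.mul_rpow (by norm_num) ha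
      _ ≤ 2 ^ β * (1 + a ^ β) := by gcongr; linarith

theorem cdf_mul_one_sub_le_exp (μ : Measure ℝ) [IsProbabilityMeasure μ] {β γ T : ℝ} (hβ : 0 ≤ β)
    (hγ : 0 ≤ γ) (hT0 : 0 ≤ T) (hint : Integrable (fun y => Real.exp (γ * |y| ^ β)) μ)
    (hT : ∫ y, Real.exp (γ * |y| ^ β) ∂μ ≤ T) (t : ℝ) :
    cdf μ t * (1 - cdf μ t) ≤ T * Real.exp γ * Real.exp (-(γ / 2 ^ β * (1 + |t|) ^ β)) := by
  refine (cdf_mul_one_sub_le μ t).trans ((measureReal_abs_ge_le μ hβ hγ hint hT t).trans ?_)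
  rw [mul_assoc, ← Real.exp_add]
  have h : γ / 2 ^ β * (1 + |t|) ^ β ≤ γ / 2 ^ β * (2 ^ β * (1 + |t| ^ β)) :=
    mul_le_mul_of_nonneg_left (one_add_rpow_le (abs_nonneg t) hβ) (by positivity)
  rw [← mul_assoc, div_mul_cancel₀ _ (by positivity)] at h
  gcongr
  linarith

/-- Half of the decay `exp(-g V)` absorbs `exp(s J V)`; the other half absorbs `V ^ 2`, by `y ^ 2 /
2 ≤ exp y` at `y = g V / 2`. -/
theorem sq_mul_exp_mul_le {g s J V A q : ℝ} (hg : 0 < g) (hJ : 0 < J) (hV : 0 ≤ V)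
    (hA : 0 ≤ A) (hsJ : s * J ≤ g / 2) (hq : q ≤ A * Real.exp (-(g * V))) :
    (s * (J * V)) ^ 2 * Real.exp (s * (J * V)) * q ≤ 8 * J ^ 2 * A / g ^ 2 * s ^ 2 := by
  have h1 : Real.exp (s * (J * V)) ≤ Real.exp (g / 2 * V) := by
    rw [← mul_assoc]
    gcongr
  have h2 : V ^ 2 ≤ 8 / g ^ 2 * Real.exp (g / 2 * V) := by
    have h0 : 0 ≤ g / 2 * V := by positivity
    have := Real.quadratic_le_exp_of_nonneg h0
    rw [div_mul_eq_mul_div, le_div_iff₀ (by positivity)]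
    nlinarith
  have he : Real.exp (g / 2 * V) * Real.exp (g / 2 * V) * Real.exp (-(g * V)) = 1 := by
    rw [← Real.exp_add, ← Real.exp_add, Real.exp_eq_one_iff]
    ring
  calc (s * (J * V)) ^ 2 * Real.exp (s * (J * V)) * q
      ≤ (s * (J * V)) ^ 2 * Real.exp (s * (J * V)) * (A * Real.exp (-(g * V))) := by gcongr
    _ ≤ (s * (J * V)) ^ 2 * Real.exp (g / 2 * V) * (A * Real.exp (-(g * V))) := by gcongr
    _ = V ^ 2 * (s ^ 2 * J ^ 2 * Real.exp (g / 2 * V) * (A * Real.exp (-(g * V)))) := by ring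
    _ ≤ 8 / g ^ 2 * Real.exp (g / 2 * V) *
        (s ^ 2 * J ^ 2 * Real.exp (g / 2 * V) * (A * Real.exp (-(g * V)))) := by gcongr
    _ = 8 * J ^ 2 * A / g ^ 2 * s ^ 2 *
        (Real.exp (g / 2 * V) * Real.exp (g / 2 * V) * Real.exp (-(g * V))) := by ring
    _ = _ := by rw [he, mul_one]

theorem exists_lintegral_inv_one_add_rpow {β : ℝ} (hβ : 1 < β) :
    ∃ J : ℝ, 0 < J ∧ ∫⁻ t : ℝ, ENNReal.ofReal (J * (1 + |t|) ^ β)⁻¹ = 1 := by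
  have hint : Integrable fun t : ℝ => (1 + |t|) ^ (-β) := by
    simpa using integrable_one_add_norm (E := ℝ) (μ := volume) (r := β) (by simpa using hβ)
  have hpos : ∀ t : ℝ, 0 < (1 + |t|) ^ (-β) := fun t => Real.rpow_pos_of_pos (by positivity) _
  have hJ : 0 < ∫ t : ℝ, (1 + |t|) ^ (-β) := by
    rw [integral_pos_iff_support_of_nonneg (fun t => (hpos t).le) hint]
    rw [show Function.support (fun t : ℝ => (1 + |t|) ^ (-β)) = Set.univ from
      Set.eq_univ_of_forall fun t => (hpos t).ne']
    simp
  refine ⟨∫ t : ℝ, (1 + |t|) ^ (-β), hJ, ?_⟩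
  set J := ∫ t : ℝ, (1 + |t|) ^ (-β) with hJdef
  have h : ∀ t : ℝ, (J * (1 + |t|) ^ β)⁻¹ = J⁻¹ * (1 + |t|) ^ (-β) := fun t => by
    rw [mul_inv, Real.rpow_neg (by positivity)]
  simp_rw [h]
  rw [← ofReal_integral_eq_lintegral_ofReal (hint.const_mul _)
    (ae_of_all _ fun t => (mul_pos (inv_pos.2 hJ) (hpos t)).le), integral_const_mul, ← hJdef,
    inv_mul_cancel₀ hJ.ne', ENNReal.ofReal_one]

/-- Sub-Gaussian deviations of the `L¹` distance on bounded ranges. -/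
theorem exists_measure_edfDist_gt_le_of_le {β γ T : ℝ} (hβ : 1 < β) (hγ : 0 < γ) (hT0 : 0 < T)
    {K : ℝ} (hK : 0 < K) :
    ∃ c : ℝ, 0 < c ∧ ∀ (μ : Measure ℝ) [IsProbabilityMeasure μ],
      Integrable (fun y => Real.exp (γ * |y| ^ β)) μ → ∫ y, Real.exp (γ * |y| ^ β) ∂μ ≤ T →
      ∀ n : ℕ, 1 ≤ n → ∀ a : ℝ, 0 ≤ a → a ≤ K →
        (Measure.pi fun _ : Fin n => μ) {x | ENNReal.ofReal a < edfDist μ x} ≤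
          ENNReal.ofReal (2 * Real.exp (-c * n * a ^ 2)) := by
  obtain ⟨J, hJ, hJ1⟩ := exists_lintegral_inv_one_add_rpow hβ
  have hβ0 : 0 ≤ β := by linarith
  set g := γ / 2 ^ β
  have hg : 0 < g := by positivity
  set A := T * Real.exp γ
  have hA : 0 < A := by positivity
  set C := 8 * J ^ 2 * A / g ^ 2
  have hC : 0 < C := by positivity
  -- The Chernoff parameter will be `s = b a`. The first term ensures `s J ≤ g / 2` for all `a ≤ K`;
  -- the second ensures `C s² ≤ s a / 2`, so half of the linear gain survives.
  set b := min (g / (2 * J * K)) (1 / (2 * C))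
  have hb : 0 < b := lt_min (by positivity) (by positivity)
  refine ⟨b / 2, by positivity, fun μ _ hint hT n hn a ha haK => ?_⟩
  have hb1 : b * (2 * J * K) ≤ g := (le_div_iff₀ (by positivity)).1 (min_le_left _ _)
  have hb2 : b * (2 * C) ≤ 1 := (le_div_iff₀ (by positivity)).1 (min_le_right _ _)
  have hV : ∀ t : ℝ, 0 < (1 + |t|) ^ β := fun t => Real.rpow_pos_of_pos (by positivity) _
  have hsJ : b * a * J ≤ g / 2 := by
    have : b * a * J ≤ b * K * J := by gcongr
    linarith
  refine (measure_edfDist_gt_le hn μ (v := fun t => J * (1 + |t|) ^ β) (by fun_prop)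
    (fun t => mul_pos hJ (hV t)) hJ1 (s := b * a) (B := C * (b * a) ^ 2) (by positivity)
    (fun t => sq_mul_exp_mul_le hg hJ (hV t).le hA.le hsJ
      (cdf_mul_one_sub_le_exp μ hβ0 hγ.le hT0.le hint hT t)) a).trans (ENNReal.ofReal_le_ofReal ?_)
  gcongr 2 * Real.exp ?_
  have h1 : b / 2 * a ^ 2 ≤ b * a * a - C * (b * a) ^ 2 := by
    have : b * (2 * C) * (b * a ^ 2) ≤ 1 * (b * a ^ 2) := by gcongr
    linarith
  have h2 := mul_le_mul_of_nonneg_left h1 (Nat.cast_nonneg (α := ℝ) n)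
  linarith


/-! ### The large deviation regime. -/

theorem abs_le_one_add_exp_div {β γ : ℝ} (hβ : 1 ≤ β) (hγ : 0 < γ) (y : ℝ) :
    |y| ≤ 1 + Real.exp (γ * |y| ^ β) / γ := by
  have h1 : |y| ≤ 1 + |y| ^ β := by
    rcases le_total |y| 1 with h | h
    · linarith [Real.rpow_nonneg (abs_nonneg y) β]
    · linarith [Real.self_le_rpow_of_one_le h hβ]
  have h2 : |y| ^ β ≤ Real.exp (γ * |y| ^ β) / γ := by
    rw [le_div_iff₀ hγ]
    linarith [Real.add_one_le_exp (γ * |y| ^ β)]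
  linarith

theorem lintegral_abs_le (μ : Measure ℝ) [IsProbabilityMeasure μ] {β γ T : ℝ} (hβ : 1 ≤ β)
    (hγ : 0 < γ) (hint : Integrable (fun y => Real.exp (γ * |y| ^ β)) μ)
    (hT : ∫ y, Real.exp (γ * |y| ^ β) ∂μ ≤ T) :
    ∫⁻ y, ENNReal.ofReal |y| ∂μ ≤ ENNReal.ofReal (1 + T / γ) := by
  have hi : Integrable (fun y => 1 + Real.exp (γ * |y| ^ β) / γ) μ :=
    (integrable_const _).add (hint.div_const γ)
  calc ∫⁻ y, ENNReal.ofReal |y| ∂μ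
      ≤ ∫⁻ y, ENNReal.ofReal (1 + Real.exp (γ * |y| ^ β) / γ) ∂μ :=
        lintegral_mono fun y => ENNReal.ofReal_le_ofReal (abs_le_one_add_exp_div hβ hγ y)
    _ = ENNReal.ofReal (∫ y, (1 + Real.exp (γ * |y| ^ β) / γ) ∂μ) :=
        (ofReal_integral_eq_lintegral_ofReal hi (ae_of_all _ fun y => by positivity)).symm
    _ ≤ _ := by
        refine ENNReal.ofReal_le_ofReal ?_
        rw [integral_add (integrable_const _) (hint.div_const γ), integral_div]
        simp only [integral_const, probReal_univ, smul_eq_mul, mul_one]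
        gcongr

/-- `cdf μ t` is the `μ`-mean of the steps `1{y ≤ t}`, so the absolute value passes inside the mean.
-/
theorem ofReal_abs_step_sub_cdf_le (μ : Measure ℝ) [IsProbabilityMeasure μ] (a t : ℝ) :
    ENNReal.ofReal |(if a ≤ t then (1 : ℝ) else 0) - cdf μ t| ≤
      ∫⁻ y, ENNReal.ofReal |(if a ≤ t then (1 : ℝ) else 0) - if y ≤ t then (1 : ℝ) else 0| ∂μ := by
  set c : ℝ := if a ≤ t then (1 : ℝ) else 0
  have hi : Integrable (fun y : ℝ => if y ≤ t then (1 : ℝ) else 0) μ :=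
    Integrable.of_bound (measurable_step measurable_id measurable_const).aestronglyMeasurable 1
      (ae_of_all _ fun y => by split_ifs <;> simp)
  have hcdf : ∫ y, (if y ≤ t then (1 : ℝ) else 0) ∂μ = cdf μ t := by
    rw [cdf_eq_real, ← integral_indicator_one measurableSet_Iic]
    refine integral_congr_ae (ae_of_all _ fun y => ?_)
    by_cases hy : y ≤ t <;> simp [hy]
  have hsub : Integrable (fun y : ℝ => c - if y ≤ t then (1 : ℝ) else 0) μ :=
    (integrable_const c).sub hi
  have h : c - cdf μ t = ∫ y, (c - if y ≤ t then (1 : ℝ) else 0) ∂μ := by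
    rw [integral_sub (integrable_const c) hi, hcdf]
    simp
  rw [h, ← ofReal_integral_eq_lintegral_ofReal hsub.abs (ae_of_all _ fun y => abs_nonneg _)]
  exact ENNReal.ofReal_le_ofReal (abs_integral_le_integral_abs)

theorem lintegral_abs_step_sub_cdf_le (μ : Measure ℝ) [IsProbabilityMeasure μ] {m : ℝ}
    (hm0 : 0 ≤ m) (hm : ∫⁻ y, ENNReal.ofReal |y| ∂μ ≤ ENNReal.ofReal m) (a : ℝ) :
    ∫⁻ t, ENNReal.ofReal |(if a ≤ t then (1 : ℝ) else 0) - cdf μ t| ≤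
      ENNReal.ofReal (|a| + m) := by
  refine (lintegral_mono fun t => ofReal_abs_step_sub_cdf_le μ a t).trans ?_
  rw [lintegral_lintegral_swap]
  · simp_rw [lintegral_abs_step_sub_step a]
    calc ∫⁻ y, ENNReal.ofReal |a - y| ∂μ
        ≤ ∫⁻ y, (ENNReal.ofReal |a| + ENNReal.ofReal |y|) ∂μ := lintegral_mono fun y => by
          rw [← ENNReal.ofReal_add (abs_nonneg _) (abs_nonneg _)]
          exact ENNReal.ofReal_le_ofReal (abs_sub a y)
      _ = ENNReal.ofReal |a| + ∫⁻ y, ENNReal.ofReal |y| ∂μ := by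
          rw [lintegral_add_left measurable_const]
          simp
      _ ≤ _ := by
          rw [ENNReal.ofReal_add (abs_nonneg _) hm0]
          gcongr
  · refine (ENNReal.measurable_ofReal.comp (Measurable.abs ?_)).aemeasurable
    exact (measurable_step measurable_const measurable_fst).sub
      (measurable_step measurable_snd measurable_fst)

/-- `Fₙ` averages the steps at the sample points, and the `L¹` distance from the step at `xᵢ` to
`cdf μ` is at most `|xᵢ| + m`. -/
theorem edfDist_le (μ : Measure ℝ) [IsProbabilityMeasure μ] {m : ℝ} (hm0 : 0 ≤ m)
    (hm : ∫⁻ y, ENNReal.ofReal |y| ∂μ ≤ ENNReal.ofReal m) {n : ℕ} (hn : 1 ≤ n)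
    (x : Fin n → ℝ) :
    edfDist μ x ≤ ENNReal.ofReal (∑ i, 1 / (n : ℝ) * |x i| + m) := by
  have hn0 : (0 : ℝ) < n := by positivity
  have hmeas : ∀ i, Measurable fun t : ℝ =>
      ENNReal.ofReal |(if x i ≤ t then (1 : ℝ) else 0) - cdf μ t| := fun i =>
    ENNReal.measurable_ofReal.comp
      ((measurable_step measurable_const measurable_id).sub (cdf μ).mono.measurable).abs
  have hpt : ∀ t, ENNReal.ofReal |edfFun x t - cdf μ t| ≤
      ∑ i, ENNReal.ofReal (1 / n) *
        ENNReal.ofReal |(if x i ≤ t then (1 : ℝ) else 0) - cdf μ t| := fun t => by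
    simp_rw [← ENNReal.ofReal_mul (one_div_pos.2 hn0).le]
    rw [← ENNReal.ofReal_sum_of_nonneg fun i _ => by positivity, ← Finset.mul_sum]
    refine ENNReal.ofReal_le_ofReal ?_
    have h := natCast_mul_edfFun_sub hn x t (cdf μ t)
    rw [show edfFun x t - cdf μ t = 1 / n * (n * (edfFun x t - cdf μ t)) by field_simp, h,
      abs_mul, abs_of_pos (one_div_pos.2 hn0)]
    gcongr
    exact Finset.abs_sum_le_sum_abs _ _
  refine (lintegral_mono hpt).trans ?_
  rw [lintegral_finsetSum _ fun i _ => (hmeas i).const_mul _]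
  calc _ ≤ ∑ i, ENNReal.ofReal (1 / n) * ENNReal.ofReal (|x i| + m) :=
        Finset.sum_le_sum fun i _ => by
          rw [lintegral_const_mul _ (hmeas i)]
          gcongr
          exact lintegral_abs_step_sub_cdf_le μ hm0 hm (x i)
    _ = ENNReal.ofReal (∑ i, 1 / (n : ℝ) * (|x i| + m)) := by
        rw [ENNReal.ofReal_sum_of_nonneg fun i _ => by positivity]
        exact Finset.sum_congr rfl fun i _ => (ENNReal.ofReal_mul (by positivity)).symm
    _ = _ := by
        congr 1
        simp_rw [mul_add]
        rw [Finset.sum_add_distrib]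
        simp only [Finset.sum_const, Finset.card_univ, Fintype.card_fin, nsmul_eq_mul]
        field_simp

/-- Large deviations of the `L¹` distance, from the exponential moments of the sample. -/
theorem measure_edfDist_gt_le_of_ge (μ : Measure ℝ) [IsProbabilityMeasure μ] {β γ T : ℝ}
    (hβ : 1 ≤ β) (hγ : 0 < γ) (hT0 : 0 < T)
    (hint : Integrable (fun y => Real.exp (γ * |y| ^ β)) μ)
    (hT : ∫ y, Real.exp (γ * |y| ^ β) ∂μ ≤ T) {n : ℕ} (hn : 1 ≤ n) {a : ℝ}
    (ha : 1 + T / γ ≤ a) :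
    (Measure.pi fun _ : Fin n => μ) {x | ENNReal.ofReal a < edfDist μ x} ≤
      ENNReal.ofReal (Real.exp (n * (Real.log T - γ * (a - (1 + T / γ)) ^ β))) := by
  set m := 1 + T / γ
  have hm0 : 0 ≤ m := by positivity
  have hn0 : (0 : ℝ) < n := by positivity
  set ε := Real.exp (n * (γ * (a - m) ^ β))
  set f : (Fin n → ℝ) → ℝ := fun x => ∏ i, Real.exp (γ * |x i| ^ β)
  have hf0 : ∀ x, 0 ≤ f x := fun x => Finset.prod_nonneg fun i _ => (Real.exp_pos _).le
  have hfi : Integrable f (Measure.pi fun _ : Fin n => μ) := Integrable.fintype_prod fun _ => hint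
  have hsub : {x : Fin n → ℝ | ENNReal.ofReal a < edfDist μ x} ⊆ {x | ε ≤ f x} := fun x hx => by
    have h1 := lt_of_lt_of_le hx
      (edfDist_le μ hm0 (lintegral_abs_le μ hβ hγ hint hT) hn x)
    have h2 : a < ∑ i, 1 / (n : ℝ) * |x i| + m := (ENNReal.ofReal_lt_ofReal_iff'.1 h1).1
    -- Power mean inequality, using `β ≥ 1`.
    have h3 : (a - m) ^ β ≤ ∑ i, 1 / (n : ℝ) * |x i| ^ β :=
      (Real.rpow_le_rpow (by linarith) (by linarith) (by linarith)).trans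
        (Real.rpow_arith_mean_le_arith_mean_rpow _ _ _ (fun _ _ => by positivity)
          (by simp [hn0.ne']) (fun _ _ => abs_nonneg _) hβ)
    change Real.exp _ ≤ ∏ i, Real.exp (γ * |x i| ^ β)
    rw [← Real.exp_sum, ← Finset.mul_sum]
    rw [← Finset.mul_sum, one_div_mul_eq_div, le_div_iff₀ hn0] at h3
    refine Real.exp_le_exp.2 ?_
    nlinarith
  have hreal : (Measure.pi fun _ : Fin n => μ).real {x | ENNReal.ofReal a < edfDist μ x} ≤
      Real.exp (n * (Real.log T - γ * (a - m) ^ β)) := by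
    refine (measureReal_mono hsub).trans ?_
    rw [mul_sub, Real.exp_sub, Real.exp_nat_mul, Real.exp_log hT0, le_div_iff₀ (Real.exp_pos _),
      mul_comm]
    refine (mul_meas_ge_le_integral_of_nonneg (ae_of_all _ hf0) hfi ε).trans ?_
    rw [integral_fintype_prod_eq_prod (fun _ y => Real.exp (γ * |y| ^ β)), Finset.prod_const,
      Finset.card_univ, Fintype.card_fin]
    exact pow_le_pow_left₀ (integral_nonneg fun _ => (Real.exp_pos _).le) hT n
  rw [← ofReal_measureReal]
  exact ENNReal.ofReal_le_ofReal hreal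

/-! ### Merging the regimes and passing to risk measures. -/

/-- The Fournier-Guillin concentration bound for the `L¹` distance. -/
theorem exists_measure_edfDist_gt_le {β γ T : ℝ} (hβ : 1 < β) (hγ : 0 < γ) (hT1 : 1 ≤ T) :
    ∃ c₂ c₃ : ℝ, 0 < c₂ ∧ 0 < c₃ ∧ ∀ (μ : Measure ℝ) [IsProbabilityMeasure μ],
      Integrable (fun y => Real.exp (γ * |y| ^ β)) μ → ∫ y, Real.exp (γ * |y| ^ β) ∂μ ≤ T →
      ∀ n : ℕ, 1 ≤ n → ∀ a : ℝ, 0 ≤ a →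
        (Measure.pi fun _ : Fin n => μ) {x | ENNReal.ofReal a < edfDist μ x} ≤
          ENNReal.ofReal (2 * (Real.exp (-c₂ * n * a ^ 2) * (if a ≤ 1 then 1 else 0) +
            Real.exp (-c₃ * n * a ^ β) * (if 1 < a then 1 else 0))) := by
  have hT0 : 0 < T := by linarith
  have hlog : 0 ≤ Real.log T := Real.log_nonneg hT1
  set m := 1 + T / γ with hm
  have hm0 : 0 ≤ m := by positivity
  -- Beyond `K` one has `a - m ≥ a / 2 ≥ 1`, and `log T ≤ γ a / 4` is absorbed by half of the
  -- exponent `γ (a / 2)^β`.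
  set K := 2 + 2 * m + 4 * Real.log T / γ with hKdef
  have hlγ : 0 ≤ 4 * Real.log T / γ := by positivity
  have hK1 : 1 ≤ K := by linarith
  have hK0 : 0 < K := by linarith
  obtain ⟨c, hc, hsmall⟩ := exists_measure_edfDist_gt_le_of_le hβ hγ hT0 hK0
  have hKβ : 0 < K ^ β := Real.rpow_pos_of_pos hK0 _
  have h2β : (0 : ℝ) < 2 ^ β := by positivity
  -- The first bound on `c₃` serves `a > K`. The second serves `1 < a ≤ K`, where `c₃ a^β ≤ c ≤ c
  -- a²`.
  refine ⟨c, min (γ / (2 * 2 ^ β)) (c / K ^ β), hc, lt_min (by positivity) (by positivity),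
    fun μ _ hint hT n hn a ha => ?_⟩
  set c₃ := min (γ / (2 * 2 ^ β)) (c / K ^ β)
  have haβ : 0 ≤ a ^ β := Real.rpow_nonneg ha _
  rcases le_or_gt a 1 with h1 | h1
  · refine (hsmall μ hint hT n hn a ha (h1.trans hK1)).trans (ENNReal.ofReal_le_ofReal ?_)
    simp [h1, not_lt.2 h1]
  rw [if_neg (not_le.2 h1), if_pos h1, mul_zero, zero_add, mul_one]
  rcases le_or_gt a K with haK | haK
  · refine (hsmall μ hint hT n hn a ha haK).trans (ENNReal.ofReal_le_ofReal ?_)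
    gcongr 2 * Real.exp ?_
    have h2 : c₃ * a ^ β ≤ c * a ^ 2 := by
      have hle : a ^ β ≤ K ^ β := Real.rpow_le_rpow ha haK (by linarith)
      calc c₃ * a ^ β ≤ c / K ^ β * K ^ β := by
            gcongr
            exact min_le_right _ _
        _ = c := div_mul_cancel₀ _ hKβ.ne'
        _ ≤ c * a ^ 2 := le_mul_of_one_le_right hc.le (one_le_pow₀ h1.le)
    have h3 := mul_le_mul_of_nonneg_left h2 (Nat.cast_nonneg (α := ℝ) n)
    linarith
  · refine (measure_edfDist_gt_le_of_ge μ hβ.le hγ hT0 hint hT hn (a := a) (by linarith)).trans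
      (ENNReal.ofReal_le_ofReal ?_)
    refine le_trans (Real.exp_le_exp.2 ?_)
      (le_mul_of_one_le_left (Real.exp_pos (-c₃ * n * a ^ β)).le one_le_two)
    have h2 : (a / 2) ^ β ≤ (a - m) ^ β :=
      Real.rpow_le_rpow (by linarith) (by linarith) (by linarith)
    have h3 : a / 2 ≤ (a / 2) ^ β := Real.self_le_rpow_of_one_le (by linarith) hβ.le
    have h4 : c₃ * a ^ β ≤ γ / 2 * (a / 2) ^ β := by
      rw [Real.div_rpow ha (by norm_num)]
      calc c₃ * a ^ β ≤ γ / (2 * 2 ^ β) * a ^ β := by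
            gcongr
            exact min_le_left _ _
        _ = _ := by field_simp
    have h5 : Real.log T ≤ γ / 2 * (a / 2) ^ β := by
      have : 4 * Real.log T / γ ≤ a := by linarith
      rw [div_le_iff₀ hγ] at this
      nlinarith
    have h6 : Real.log T - γ * (a - m) ^ β ≤ -(c₃ * a ^ β) := by nlinarith
    have h7 := mul_le_mul_of_nonneg_left h6 (Nat.cast_nonneg (α := ℝ) n)
    linarith

/-- Deviation of a type T1 risk measure in terms of the law of the sample. -/
theorem measureReal_abs_risk_sub_gt_le {Ω Ω' : Type*} [MeasurableSpace Ω] [MeasurableSpace Ω']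
    {P : Measure Ω} [IsProbabilityMeasure P] {X : Ω → ℝ}
    {P' : Measure Ω'} [IsProbabilityMeasure P'] {n : ℕ} (hn : 1 ≤ n) {Y : Fin n → Ω' → ℝ}
    (hY : IsIIDSample Y P' X P) {ρ : CDF → ℝ} {L κ : ℝ} (hρ : IsType1 ρ L κ) {ε b : ℝ}
    (hε : 0 < ε) (hb : 0 ≤ b)
    (h : (Measure.pi fun _ : Fin n => P.map X)
      {x | ENNReal.ofReal ((ε / L) ^ (1 / κ)) < edfDist (P.map X) x} ≤ ENNReal.ofReal b) :
    P'.real {ω | ε < |ρ (edf hn fun i => Y i ω) - ρ (cdfOf X P)|} ≤ b := by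
  have hYm : ∀ i, AEMeasurable (Y i) P' := fun i => (hY.identDistrib i).aemeasurable_fst
  have hlaw : P'.map (fun ω i => Y i ω) = Measure.pi fun _ : Fin n => P.map X := by
    rw [(iIndepFun_iff_map_fun_eq_pi_map hYm).1 hY.indep]
    congr 1
    exact funext fun i => (hY.identDistrib i).map_eq
  refine ENNReal.toReal_le_of_le_ofReal hb (le_trans ?_ h)
  rw [← hlaw]
  -- As `ρ` is arbitrary, the event need not be measurable; only monotonicity and the one-sided
  -- bound for preimages are used.
  refine le_trans (measure_mono fun ω hω => ?_)
    (Measure.le_map_apply (aemeasurable_pi_lambda _ hYm) _)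
  exact (hρ.lt_W1 hε hω).trans_le (W1_le_lintegral _ _)

theorem exists_deviation_bound {β γ T : ℝ} (hβ : 1 < β) (hγ : 0 < γ) :
    ∃ c₂ c₃ : ℝ, 0 < c₂ ∧ 0 < c₃ ∧
      ∀ {Ω : Type*} [MeasurableSpace Ω] (P : Measure Ω) [IsProbabilityMeasure P] (X : Ω → ℝ),
        ExpMomentBound X P β γ T →
      ∀ (ρ : CDF → ℝ) (L κ : ℝ), IsType1 ρ L κ →
      ∀ (n : ℕ) (hn : 1 ≤ n) {Ω' : Type*} [MeasurableSpace Ω'] (P' : Measure Ω')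
        [IsProbabilityMeasure P'] (Y : Fin n → Ω' → ℝ), IsIIDSample Y P' X P →
      ∀ ε : ℝ, 0 < ε →
        P'.real {ω | ε < |ρ (edf hn (fun i => Y i ω)) - ρ (cdfOf X P)|}
          ≤ 2 * (Real.exp (-c₂ * n * (ε / L) ^ (2 / κ)) * (if ε ≤ L then 1 else 0)
              + Real.exp (-c₃ * n * (ε / L) ^ (β / κ)) * (if L < ε then 1 else 0)) := by
  obtain ⟨c₂, c₃, hc₂, hc₃, hmain⟩ :=
    -- Raising `T` to at least `1` keeps `log T` nonnegative.
    exists_measure_edfDist_gt_le hβ hγ (le_max_right T 1)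
  refine ⟨c₂, c₃, hc₂, hc₃, ?_⟩
  intro Ω _ P _ X hX ρ L κ hρ n hn Ω' _ P' _ Y hY ε hε
  have hμ : IsProbabilityMeasure (P.map X) := Measure.isProbabilityMeasure_map hX.aemeasurable
  have hmeas : Measurable fun y : ℝ => Real.exp (γ * |y| ^ β) := by fun_prop
  have hint : Integrable (fun y => Real.exp (γ * |y| ^ β)) (P.map X) :=
    (integrable_map_measure hmeas.aestronglyMeasurable hX.aemeasurable).2 hX.integrable
  have hT : ∫ y, Real.exp (γ * |y| ^ β) ∂(P.map X) ≤ max T 1 := by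
    rw [integral_map hX.aemeasurable hmeas.aestronglyMeasurable]
    exact hX.bound.le.trans (le_max_left _ _)
  have hr : 0 < ε / L := div_pos hε hρ.L_pos
  have hκ : 0 < 1 / κ := one_div_pos.2 hρ.κ_pos
  have h := hmain (P.map X) hint hT n hn ((ε / L) ^ (1 / κ)) (Real.rpow_nonneg hr.le _)
  have hle : (ε / L) ^ (1 / κ) ≤ 1 ↔ ε ≤ L := by
    rw [Real.rpow_le_one_iff_of_pos hr, div_le_one hρ.L_pos, one_le_div hρ.L_pos]
    exact ⟨fun h => h.elim (fun h => absurd h.2 (not_le.2 hκ)) And.left, fun h => Or.inr ⟨h, hκ.le⟩⟩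
  have hpow : ∀ q : ℝ, ((ε / L) ^ (1 / κ)) ^ q = (ε / L) ^ (q / κ) := fun q => by
    rw [← Real.rpow_mul hr.le, one_div_mul_eq_div]
  have hsq : ((ε / L) ^ (1 / κ)) ^ 2 = (ε / L) ^ (2 / κ) := by
    rw [← Real.rpow_natCast, hpow]
    norm_num
  simp only [← not_le, hle, hpow, hsq] at h
  simp only [← not_le (a := ε)]
  refine measureReal_abs_risk_sub_gt_le hn hY hρ hε ?_ (by simpa using h)
  split_ifs <;> positivity

/-- The value `3` makes room for the strict inequality in `ExpMomentBound`; the sub-Gaussian bound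
by `2` is not strict. -/
theorem IsSubGaussian.expMomentBound {Ω : Type*} [MeasurableSpace Ω] {P : Measure Ω} {X : Ω → ℝ}
    {γ : ℝ} (h : IsSubGaussian X P γ) : ExpMomentBound X P 2 γ 3 := by
  have hsq : ∀ ω, |X ω| ^ (2 : ℝ) = X ω ^ 2 := fun ω => by
    rw [Real.rpow_two, sq_abs]
  refine ⟨h.aemeasurable, ?_, ?_⟩
  · simpa only [hsq] using h.integrable
  · simp only [hsq]
    linarith [h.bound]

end RiskMeasure

theorem mainTheorem1 :
    (∀ β γ T : ℝ, 1 < β → 0 < γ →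
      ∃ c₁ c₂ c₃ : ℝ, 0 < c₁ ∧ 0 < c₂ ∧ 0 < c₃ ∧
        ∀ (Ω : Type*) [MeasurableSpace Ω] (P : Measure Ω) [IsProbabilityMeasure P] (X : Ω → ℝ),
          RiskMeasure.ExpMomentBound X P β γ T →
        ∀ (ρ : RiskMeasure.CDF → ℝ) (L κ : ℝ), RiskMeasure.IsType1 ρ L κ →
        ∀ (n : ℕ) (hn : 1 ≤ n) (Ω' : Type*) [MeasurableSpace Ω'] (P' : Measure Ω')
          [IsProbabilityMeasure P'] (Y : Fin n → Ω' → ℝ),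
          RiskMeasure.IsIIDSample Y P' X P →
        ∀ ε : ℝ, 0 < ε →
          P'.real {ω | ε < |ρ (RiskMeasure.edf hn (fun i => Y i ω)) - ρ (RiskMeasure.cdfOf X P)|}
            ≤ c₁ * (Real.exp (-c₂ * n * (ε / L) ^ (2 / κ)) * (if ε ≤ L then 1 else 0)
                + Real.exp (-c₃ * n * (ε / L) ^ (β / κ)) * (if L < ε then 1 else 0))) ∧
    (∀ γ : ℝ, 0 < γ →
      ∃ c₁ c₂ : ℝ, 0 < c₁ ∧ 0 < c₂ ∧
        ∀ (Ω : Type*) [MeasurableSpace Ω] (P : Measure Ω) [IsProbabilityMeasure P] (X : Ω → ℝ),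
          RiskMeasure.IsSubGaussian X P γ →
        ∀ (ρ : RiskMeasure.CDF → ℝ) (L κ : ℝ), RiskMeasure.IsType1 ρ L κ →
        ∀ (n : ℕ) (hn : 1 ≤ n) (Ω' : Type*) [MeasurableSpace Ω'] (P' : Measure Ω')
          [IsProbabilityMeasure P'] (Y : Fin n → Ω' → ℝ),
          RiskMeasure.IsIIDSample Y P' X P →
        ∀ ε : ℝ, 0 ≤ ε →
          P'.real {ω | ε < |ρ (RiskMeasure.edf hn (fun i => Y i ω)) - ρ (RiskMeasure.cdfOf X P)|}
              ≤ 2 * c₁ * Real.exp (-c₂ * n * (ε / L) ^ (2 / κ)) ∧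
          (κ = 1 →
            P'.real {ω | ε < |ρ (RiskMeasure.edf hn (fun i => Y i ω)) -
                ρ (RiskMeasure.cdfOf X P)|}
              ≤ 2 * c₁ * Real.exp (-(c₂ / L ^ 2) * n * ε ^ 2))) := by
  refine ⟨fun β γ T hβ hγ => ?_, fun γ hγ => ?_⟩
  · obtain ⟨c₂, c₃, hc₂, hc₃, h⟩ := RiskMeasure.exists_deviation_bound (T := T) hβ hγ
    exact ⟨2, c₂, c₃, two_pos, hc₂, hc₃, fun Ω _ P _ X hX ρ L κ hρ n hn Ω' _ P' _ Y hY ε hε =>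
      h P X hX ρ L κ hρ n hn P' Y hY ε hε⟩
  · obtain ⟨c₂, c₃, hc₂, hc₃, h⟩ :=
      RiskMeasure.exists_deviation_bound (β := 2) (T := 3) one_lt_two hγ
    refine ⟨1, min c₂ c₃, one_pos, lt_min hc₂ hc₃, ?_⟩
    intro Ω _ P _ X hX ρ L κ hρ n hn Ω' _ P' _ Y hY ε hε
    have key : P'.real {ω | ε < |ρ (RiskMeasure.edf hn (fun i => Y i ω)) -
        ρ (RiskMeasure.cdfOf X P)|} ≤
        2 * 1 * Real.exp (-min c₂ c₃ * n * (ε / L) ^ (2 / κ)) := by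
      rcases hε.eq_or_lt with rfl | hε
      -- At `ε = 0` the right-hand side equals `2`, so the bound is trivial.
      · rw [zero_div, Real.zero_rpow (div_pos two_pos hρ.κ_pos).ne', mul_zero, Real.exp_zero]
        exact measureReal_le_one.trans (by norm_num)
      · refine (h P X hX.expMomentBound ρ L κ hρ n hn P' Y hY ε hε).trans ?_
        have hr : 0 ≤ (ε / L) ^ (2 / κ) := Real.rpow_nonneg (div_pos hε hρ.L_pos).le _
        have h2 : Real.exp (-c₂ * n * (ε / L) ^ (2 / κ)) ≤
            Real.exp (-min c₂ c₃ * n * (ε / L) ^ (2 / κ)) := by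
          gcongr
          exact min_le_left _ _
        have h3 : Real.exp (-c₃ * n * (ε / L) ^ (2 / κ)) ≤
            Real.exp (-min c₂ c₃ * n * (ε / L) ^ (2 / κ)) := by
          gcongr
          exact min_le_right _ _
        rcases le_or_gt ε L with hL | hL
        · rw [if_pos hL, if_neg (not_lt.2 hL)]
          linarith
        · rw [if_neg (not_le.2 hL), if_pos hL]
          linarith
    refine ⟨key, fun hκ => key.trans (le_of_eq ?_)⟩
    rw [hκ, div_one, Real.rpow_two, div_pow]
    congr 2
    ring
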